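/- Consider the $K$-user interference channel with single-antenna nodes over the scalars $\mathbb F=\mathbb R$ or $\mathbb F=\mathbb C$: in time slot $t$ receiver $k$ observes $y^{[k]}(t)=\sum_{j=1}^K h^{[kj]}(t)x^{[j]}(t)+z^{[k]}(t)$, where the noise is white Gaussian (circularly symmetric if $\mathbb F=\mathbb C$) of variance $v>0$ per real dimension, and every transmitter has average power at most $P$. The channels follow a staggered block fading model with coherence time $T=2$: every coefficient is constant over blocks of two slots, all direct channels $h^{[kk]}$ have the same block boundaries, all cross channels $h^{[kj]}$, $j\ne k$, have the same block boundaries, and each cross-channel block consists of the second slot of a direct-channel block and the first slot of the next one (such a pair of slots is called a supersymbol). For each channel the sequence of its block states is stationary, and its states in two successive blocks have a joint density; no independence across blocks or channels is assumed. The transmitters know the block structure and the channel statistics but not the channel realization (no CSIT); each receiver knows the realization of its incoming channels (perfect CSIR). Then a total of $K/2$ DoF is achievable almost surely. More precisely, there are codes, one for every power $P$ and every length $n$ and not depending on the channel realization at the encoders, in which every user repeats its symbol over each supersymbol (one coded stream along the beamforming vector $[1\ 1]^T$), such that for almost every realization of the channel coefficients: (i) over every supersymbol and at every receiver, all interfering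 streams are received along $[1\ 1]^T$, and the desired stream is received along a linearly independent direction; (ii) there are rates $R_k(P)$ with $\lim_{P\to\infty}R_k(P)/\big(\tfrac r2\log P\big)=\tfrac12$, where $r=\dim_{\mathbb R}\mathbb F$, for $k=1,\dots,K$, so that the DoF add up to $K/2$, and for all sufficiently large $P$ the codes of power $P$ eventually have at least $e^{nR_k(P)}$ messages for user $k$, and their error probability for the given realization tends to $0$ as $n\to\infty$. -/

import Mathlib

open MeasureTheory Filter Topology
open scoped NNReal

/-! ### Staggered block fading with coherence time two -/

/-- Index of the coherence block of the direct channels that contains time slot `t`.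
The natural number `s` fixes the position of the time origin relative to the block boundaries. -/
def directBlock (s t : ℕ) : ℕ := (t + s) / 2

/-- Index of the coherence block of the cross channels that contains time slot `t`. The boundaries
are staggered with respect to those of the direct channels: each cross block consists of the second
slot of a direct block and the first slot of the next one. -/
def crossBlock (s t : ℕ) : ℕ := (t + s + 1) / 2

/-- The assumptions on the block states. `S b k j` is the random state, in its coherence block `b`,
of the channel from transmitter `j` to receiver `k`. Each channel has a stationary sequence of block
states, and its states in two successive blocks have a joint density. No independence is assumed,
neither across blocks nor across channels, and ergodicity is not assumed either. -/
structure IsGenericBlockFading {𝕜 : Type*} [RCLike 𝕜] {Ω : Type*} [MeasurableSpace Ω]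
    (μ : Measure Ω) {K : ℕ} (S : ℕ → Fin K → Fin K → Ω → 𝕜) : Prop where
  measurable : ∀ b k j, Measurable (S b k j)
  stationary : ∀ k j,
    μ.map (fun ω (b : ℕ) => S (b + 1) k j ω) = μ.map (fun ω (b : ℕ) => S b k j ω)
  generic : ∀ b k j, μ.map (fun ω => (S b k j ω, S (b + 1) k j ω)) ≪
    (Measure.addHaar : Measure 𝕜).prod (Measure.addHaar : Measure 𝕜)

/-- The realization of the channel coefficients: `channel s S ω t k j` is the coefficient in time
slot `t` of the channel from transmitter `j` to receiver `k`. -/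
def channel {𝕜 : Type*} {Ω : Type*} {K : ℕ} (s : ℕ) (S : ℕ → Fin K → Fin K → Ω → 𝕜) (ω : Ω) :
    ℕ → Fin K → Fin K → 𝕜 :=
  fun t k j => if k = j then S (directBlock s t) k j ω else S (crossBlock s t) k j ω

/-! ### Codes, noise and error probability -/

/-- The law of one sample of additive white Gaussian noise, with variance `v` per real dimension:
`N(0, v)` over the reals (where `RCLike.I = 0`) and circularly symmetric over the complex numbers. -/
noncomputable def awgn (𝕜 : Type*) [RCLike 𝕜] (v : ℝ≥0) : Measure 𝕜 :=
  ((ProbabilityTheory.gaussianReal 0 v).prod (ProbabilityTheory.gaussianReal 0 v)).map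
    (fun p : ℝ × ℝ => (p.1 : 𝕜) + (p.2 : 𝕜) * RCLike.I)

/-- A code of length `n` for the `K` user interference channel with average power constraint `P`.
The encoders have no access to the channel coefficients. The decoder of receiver `k` is given the
coefficients of its incoming channels over the `n` slots, and its received signal. -/
structure ICCode (𝕜 : Type*) [RCLike 𝕜] (K n : ℕ) (P : ℝ≥0) where
  /-- the number of messages of each user -/
  M : Fin K → ℕ
  M_pos : ∀ k, 0 < M k
  /-- the encoders -/
  enc : ∀ k, Fin (M k) → Fin n → 𝕜
  power_le : ∀ k m, ∑ t, ‖enc k m t‖ ^ 2 ≤ (n : ℝ) * P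
  /-- the decoders -/
  dec : ∀ k, (Fin n → Fin K → 𝕜) → (Fin n → 𝕜) → Fin (M k)
  measurable_dec : ∀ k,
    Measurable (fun p : (Fin n → Fin K → 𝕜) × (Fin n → 𝕜) => dec k p.1 p.2)

namespace ICCode

variable {𝕜 : Type*} [RCLike 𝕜] {K n : ℕ} {P : ℝ≥0}

/-- The signal at receiver `k`, for channel coefficients `h`, messages `m` and noise `z`. -/
noncomputable def received (c : ICCode 𝕜 K n P) (h : ℕ → Fin K → Fin K → 𝕜)
    (m : ∀ k, Fin (c.M k)) (z : Fin n → Fin K → 𝕜) (k : Fin K) : Fin n → 𝕜 :=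
  fun t => ∑ j, h t k j * c.enc j (m j) t + z t k

/-- The probability, for channel coefficients `h`, that some receiver does not recover its message,
for independent uniform messages and noise that is independent over slots and receivers. -/
noncomputable def errorProb (c : ICCode 𝕜 K n P) (v : ℝ≥0) (h : ℕ → Fin K → Fin K → 𝕜) : ℝ :=
  (∑ m : (∀ k, Fin (c.M k)),
    (Measure.pi fun _ : Fin n => Measure.pi fun _ : Fin K => awgn 𝕜 v).real
      {z | ∃ k, c.dec k (fun t => h t k) (c.received h m z k) ≠ m k}) / ∏ k, (c.M k : ℝ)

/-- Over each supersymbol (two consecutive slots in one cross-channel block) every user repeats its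
symbol: it sends a single scalar coded stream along the beamforming vector `[1 1]ᵀ`. -/
def IsRepetition (c : ICCode 𝕜 K n P) (s : ℕ) : Prop :=
  ∀ k m (t t' : Fin n), crossBlock s t = crossBlock s t' → c.enc k m t = c.enc k m t'

end ICCode

/-! ### Degrees of freedom and alignment -/

/-- The family of codes `C` (one for each power and length) achieves `d k` degrees of freedom for
each user `k` on the channel realization `h`: there are rates `R P k` (in nats per slot) with
`R P k = (d k + o(1)) * (r / 2) * log P`, where `r` is the real dimension of the field of scalars
(so that the point-to-point channel has one degree of freedom), such that for all large powers the
codes have these rates and an error probability that tends to zero with the length. -/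
def AchievesDoF {𝕜 : Type*} [RCLike 𝕜] {K : ℕ} (v : ℝ≥0)
    (C : (P : ℝ≥0) → (n : ℕ) → ICCode 𝕜 K n P) (d : Fin K → ℝ)
    (h : ℕ → Fin K → Fin K → 𝕜) : Prop :=
  ∃ R : ℝ≥0 → Fin K → ℝ,
    (∀ k, Tendsto (fun P : ℝ≥0 => R P k / ((Module.finrank ℝ 𝕜 : ℝ) / 2 * Real.log P)) atTop
      (𝓝 (d k))) ∧
    ∀ᶠ P : ℝ≥0 in atTop,
      (∀ k, ∀ᶠ n : ℕ in atTop, Real.exp (n * R P k) ≤ ((C P n).M k : ℝ)) ∧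
      Tendsto (fun n : ℕ => (C P n).errorProb v h) atTop (𝓝 0)

/-- The direction along which receiver `k` sees, over the slots `t` and `t + 1`, a stream that
transmitter `j` sends along `[1 1]ᵀ`. -/
def receivedDirection {𝕜 : Type*} {K : ℕ} (h : ℕ → Fin K → Fin K → 𝕜) (t : ℕ) (k j : Fin K) :
    Fin 2 → 𝕜 :=
  ![h t k j, h (t + 1) k j]

/-- Over every supersymbol and at every receiver, all interfering streams lie along `[1 1]ᵀ`, and
the desired stream arrives along a linearly independent direction. -/
def InterferenceAligned {𝕜 : Type*} [RCLike 𝕜] {K : ℕ} (s : ℕ)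
    (h : ℕ → Fin K → Fin K → 𝕜) : Prop :=
  ∀ t, crossBlock s t = crossBlock s (t + 1) → ∀ k,
    (∀ j, j ≠ k → receivedDirection h t k j ∈ Submodule.span 𝕜 {(![1, 1] : Fin 2 → 𝕜)}) ∧
    LinearIndependent 𝕜 ![receivedDirection h t k k, (![1, 1] : Fin 2 → 𝕜)]

/-! A deterministic code, used by all users, that works on almost every channel realization.

Every user repeats a symbol over the two slots of a supersymbol. The cross channels are constant
there, so that the difference of the two received samples is free of interference: the receiver sees
the transmitted symbols through the increments `g i` of its direct channel and some noise. The direct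
channel almost surely changes between successive blocks (`IsGenericBlockFading.ae_ne`), which gives
the alignment, and says that no `g i` vanishes.

The rate rests on the fact that few of the `g i` are small, uniformly in time. Garsia's maximal
ergodic theorem (`setIntegral_birkhoffMax_pos_nonneg`) shows, without ergodicity, that for fixed
`l > 0` the event that for some `N` more than `l * N` of the first `N` increments are smaller than
`ε` has a probability that tends to zero with `ε`
(`tendsto_measure_exists_card_small_increment`). By Borel–Cantelli there are `ε j > 0` such that
almost every realization satisfies this with `l = 1 / (j + 5)` and `ε = ε j` for all large `j`.

For fixed `ε` and `l` (`eventually_exists_isReliableRepetition`), take a grid constellation in the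
ball of radius `√P` whose minimum distance does not depend on `P`, and is so large that at a
supersymbol with `‖g i‖ ≥ ε` the noise rarely causes a symbol error. The outer code, from the
Gilbert–Varshamov bound (`exists_code_lt_hammingDist`), has relative minimum distance `4 * l`, so that
it tolerates arbitrary errors in a fraction `l` of weak supersymbols and in another fraction `l` of
supersymbols with large noise; more large noise samples than that have exponentially small
probability (`measure_pi_le_card_filter_le`). The constellation has
`(r / 2) log P + O(1)` nats per symbol, and the outer code loses a fraction `4 * l` of them and one
bit. A supersymbol takes two slots, so that `(1 - 6 * l) / 2` degrees of freedom remain for large `P`,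
with codes that do not depend on the channel realization. Finally `j` tends to infinity with `P`,
slowly enough for the construction to apply (`exists_tendsto_atTop_eventually`). -/

/-! ### The maximal ergodic inequality -/

/-- The maximum of `0` and of the first `n` Birkhoff sums of `f` along `T`, defined by the recursion
that this maximum satisfies. -/
noncomputable def birkhoffMax {α : Type*} (T : α → α) (f : α → ℝ) : ℕ → α → ℝ
  | 0 => fun _ => 0
  | n + 1 => fun x => max 0 (f x + birkhoffMax T f n (T x))

section Maximal

variable {α : Type*} {T : α → α} {f : α → ℝ}

lemma birkhoffMax_nonneg (n : ℕ) (x : α) : 0 ≤ birkhoffMax T f n x := by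
  cases n with
  | zero => exact le_rfl
  | succ n => exact le_max_left _ _

lemma birkhoffMax_le_succ (n : ℕ) (x : α) : birkhoffMax T f n x ≤ birkhoffMax T f (n + 1) x := by
  induction n generalizing x with
  | zero => exact birkhoffMax_nonneg 1 x
  | succ n ih => exact max_le_max le_rfl (add_le_add le_rfl (ih (T x)))

lemma monotone_birkhoffMax (x : α) : Monotone fun n => birkhoffMax T f n x :=
  monotone_nat_of_le_succ fun n => birkhoffMax_le_succ n x

lemma birkhoffSum_le_birkhoffMax (n : ℕ) (x : α) : birkhoffSum T f n x ≤ birkhoffMax T f n x := by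
  induction n generalizing x with
  | zero => simp [birkhoffMax]
  | succ n ih =>
    rw [birkhoffSum_succ']
    exact (add_le_add le_rfl (ih (T x))).trans (le_max_right _ _)

variable [MeasurableSpace α] {ν : Measure α}

lemma measurable_birkhoffMax (hT : Measurable T) (hf : Measurable f) (n : ℕ) :
    Measurable (birkhoffMax T f n) := by
  induction n with
  | zero => exact measurable_const
  | succ n ih => exact measurable_const.max (hf.add (ih.comp hT))

lemma integrable_birkhoffMax (hT : MeasurePreserving T ν ν) (hf : Integrable f ν) (n : ℕ) :
    Integrable (birkhoffMax T f n) ν := by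
  induction n with
  | zero => exact integrable_zero _ _ _
  | succ n ih =>
    exact (integrable_zero _ _ _).sup (hf.add (hT.integrable_comp_of_integrable ih))

/-- The maximal ergodic theorem, by Garsia's argument: where the maximum `M` of the Birkhoff sums is
positive, `f` is at least `M - M ∘ T`, and this difference integrates to zero. -/
theorem setIntegral_birkhoffMax_pos_nonneg (hT : MeasurePreserving T ν ν) (hfm : Measurable f)
    (hf : Integrable f ν) (n : ℕ) : 0 ≤ ∫ x in {x | 0 < birkhoffMax T f n x}, f x ∂ν := by
  cases n with
  | zero => simp [birkhoffMax]
  | succ n =>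
    set M := birkhoffMax T f (n + 1) with hM
    have hMm : Measurable M := measurable_birkhoffMax hT.measurable hfm _
    have hMi : Integrable M ν := integrable_birkhoffMax hT hf _
    have hMTi : Integrable (fun x => M (T x)) ν := hT.integrable_comp_of_integrable hMi
    have hA : MeasurableSet {x | 0 < M x} := measurableSet_lt measurable_const hMm
    have h0 : ∀ x, 0 ≤ M x := birkhoffMax_nonneg _
    have h1 : ∫ x in {x | 0 < M x}, M x ∂ν = ∫ x, M x ∂ν := by
      refine setIntegral_eq_integral_of_forall_compl_eq_zero fun x hx => ?_
      exact le_antisymm (not_lt.1 hx) (h0 x)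
    have h2 : ∫ x in {x | 0 < M x}, M (T x) ∂ν ≤ ∫ x, M (T x) ∂ν :=
      setIntegral_le_integral hMTi (Eventually.of_forall fun x => h0 _)
    have h3 : ∫ x, M (T x) ∂ν = ∫ x, M x ∂ν := by
      have := integral_map hT.aemeasurable (f := M) (μ := ν) hMm.aestronglyMeasurable
      rw [hT.map_eq] at this
      exact this.symm
    have h4 : ∫ x in {x | 0 < M x}, (M x - M (T x)) ∂ν ≤ ∫ x in {x | 0 < M x}, f x ∂ν := by
      refine setIntegral_mono_on (hMi.sub hMTi).integrableOn hf.integrableOn hA fun x hx => ?_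
      have h5 : M x = max 0 (f x + birkhoffMax T f n (T x)) := rfl
      have h6 : birkhoffMax T f n (T x) ≤ M (T x) := birkhoffMax_le_succ n (T x)
      have h7 : (0 : ℝ) < M x := hx
      rcases max_cases (0 : ℝ) (f x + birkhoffMax T f n (T x)) with h | h <;> linarith
    rw [integral_sub hMi.integrableOn hMTi.integrableOn] at h4
    linarith

/-- The maximal inequality for visits to a set `E`: it is unlikely that the orbit has, up to some
time, spent more than a fraction `l` of the time in `E`. -/
theorem measureReal_exists_lt_birkhoffSum_le [IsProbabilityMeasure ν]
    (hT : MeasurePreserving T ν ν) {E : Set α} (hE : MeasurableSet E) (l : ℝ) :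
    l * ν.real {x | ∃ n : ℕ, l * n < birkhoffSum T (E.indicator fun _ => (1 : ℝ)) n x} ≤
      ν.real E := by
  rcases le_or_gt l 0 with hl | hl
  · exact (mul_nonpos_of_nonpos_of_nonneg hl measureReal_nonneg).trans measureReal_nonneg
  set f : α → ℝ := fun x => E.indicator (fun _ => (1 : ℝ)) x - l with hf
  have hi1 : Integrable (E.indicator fun _ => (1 : ℝ)) ν := (integrable_const _).indicator hE
  have hfi : Integrable f ν := hi1.sub (integrable_const _)
  have hfm : Measurable f := (measurable_const.indicator hE).sub measurable_const
  have hsum : ∀ n x, birkhoffSum T f n x =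
      birkhoffSum T (E.indicator fun _ => (1 : ℝ)) n x - l * n := by
    intro n x
    simp [birkhoffSum, hf, mul_comm]
  have hsub : {x | ∃ n : ℕ, l * n < birkhoffSum T (E.indicator fun _ => (1 : ℝ)) n x} ⊆
      ⋃ n, {x | 0 < birkhoffMax T f n x} := by
    rintro x ⟨n, hn⟩
    refine Set.mem_iUnion.2 ⟨n, lt_of_lt_of_le ?_ (birkhoffSum_le_birkhoffMax n x)⟩
    rw [hsum]
    linarith
  have hmono : Monotone fun n => {x | 0 < birkhoffMax T f n x} :=
    fun m n hmn x hx => lt_of_lt_of_le hx (monotone_birkhoffMax x hmn)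
  have hbound : ∀ n, ν.real {x | 0 < birkhoffMax T f n x} ≤ ν.real E / l := by
    intro n
    have h := setIntegral_birkhoffMax_pos_nonneg hT hfm hfi n
    rw [hf, integral_sub hi1.integrableOn (integrable_const _).integrableOn] at h
    rw [setIntegral_indicator hE] at h
    simp only [integral_const, smul_eq_mul, mul_one, measureReal_restrict_apply_univ] at h
    rw [le_div_iff₀ hl]
    have := measureReal_mono (μ := ν)
      (Set.inter_subset_right (s := {x | 0 < birkhoffMax T f n x}) (t := E))
    linarith
  have hlim := tendsto_measure_iUnion_atTop (μ := ν) hmono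
  have hlim' : Tendsto (fun n => ν.real {x | 0 < birkhoffMax T f n x}) atTop
      (𝓝 (ν.real (⋃ n, {x | 0 < birkhoffMax T f n x}))) :=
    (ENNReal.tendsto_toReal (measure_ne_top _ _)).comp hlim
  have h1 := le_of_tendsto' hlim' hbound
  rw [mul_comm, ← le_div_iff₀ hl]
  exact (measureReal_mono hsub).trans h1

end Maximal

/-! ### Stationary sequences are rarely close to repeating a value -/

/-- If the consecutive terms of a stationary sequence are almost surely distinct, then it is
unlikely that, for some `N`, more than a fraction `l` of the first `N` increments are smaller than
`ε`, and the more so the smaller `ε` is. -/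
theorem tendsto_measure_exists_card_small_increment {𝕜 Ω : Type*} [RCLike 𝕜] [MeasurableSpace Ω]
    {μ : Measure Ω} [IsProbabilityMeasure μ] {X : ℕ → Ω → 𝕜} (hX : ∀ b, Measurable (X b))
    (hst : μ.map (fun ω (b : ℕ) => X (b + 1) ω) = μ.map (fun ω (b : ℕ) => X b ω))
    (c : ℕ) (hne : ∀ᵐ ω ∂μ, X c ω ≠ X (c + 1) ω) {l : ℝ} (hl : 0 < l) :
    Tendsto (fun ε : ℝ => μ {ω | ∃ N : ℕ,
      l * N < ((Finset.range N).filter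
        (fun i => ‖X (c + i + 1) ω - X (c + i) ω‖ < ε)).card}) (𝓝[>] 0) (𝓝 0) := by
  have hXm : Measurable fun ω (b : ℕ) => X b ω := measurable_pi_lambda _ hX
  set ν := μ.map (fun ω (b : ℕ) => X b ω) with hν
  have : IsProbabilityMeasure ν := Measure.isProbabilityMeasure_map hXm.aemeasurable
  let T : (ℕ → 𝕜) → (ℕ → 𝕜) := fun x b => x (b + 1)
  have hTm : Measurable T := measurable_pi_lambda _ fun b => measurable_pi_apply _
  have hT : MeasurePreserving T ν ν := by
    refine ⟨hTm, ?_⟩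
    rw [hν, Measure.map_map hTm hXm]
    exact hst
  have hiter : ∀ (i : ℕ) (x : ℕ → 𝕜) (b : ℕ), (T^[i] x) b = x (b + i) := by
    intro i
    induction i with
    | zero => intro x b; rfl
    | succ i ih =>
      intro x b
      rw [Function.iterate_succ_apply, ih]
      rfl
  let E : ℝ → Set (ℕ → 𝕜) := fun ε => {x | ‖x (c + 1) - x c‖ < ε}
  have hE : ∀ ε, MeasurableSet (E ε) := fun ε =>
    measurableSet_lt (by fun_prop) measurable_const
  have hsum : ∀ ε N ω, birkhoffSum T ((E ε).indicator fun _ => (1 : ℝ)) N (fun b => X b ω) =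
      ((Finset.range N).filter (fun i => ‖X (c + i + 1) ω - X (c + i) ω‖ < ε)).card := by
    intro ε N ω
    rw [birkhoffSum, Finset.card_filter]
    push_cast
    refine Finset.sum_congr rfl fun i _ => ?_
    simp only [Set.indicator_apply, E, Set.mem_ofPred_eq, hiter]
    rw [show c + 1 + i = c + i + 1 by ring]
  have hEzero : Tendsto (fun ε => ν (E ε)) (𝓝[>] 0) (𝓝 0) := by
    have h := tendsto_measure_biInter_gt (μ := ν) (s := E) (a := 0)
      (fun r _ => (hE r).nullMeasurableSet)
      (fun i j _ hij x hx => lt_of_lt_of_le hx hij) ⟨1, one_pos, measure_ne_top _ _⟩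
    have h0 : ν (⋂ r > 0, E r) = 0 := by
      have hms : MeasurableSet {x : ℕ → 𝕜 | x c = x (c + 1)} :=
        measurableSet_eq_fun (measurable_pi_apply _) (measurable_pi_apply _)
      refine measure_mono_null (t := {x : ℕ → 𝕜 | x c = x (c + 1)}) ?_ ?_
      · intro x hx
        simp only [Set.mem_iInter, E, Set.mem_ofPred_eq] at hx
        have : ‖x (c + 1) - x c‖ ≤ 0 := le_of_forall_gt_imp_ge_of_dense fun r hr => (hx r hr).le
        exact (sub_eq_zero.1 (norm_le_zero_iff.1 this)).symm
      · rw [hν, Measure.map_apply hXm hms]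
        simpa [ae_iff] using hne
    rwa [h0] at h
  refine tendsto_of_tendsto_of_tendsto_of_le_of_le (h := fun ε => ν (E ε) / ENNReal.ofReal l)
    tendsto_const_nhds ?_ (fun _ => zero_le) ?_
  · have := ENNReal.Tendsto.div_const hEzero (b := ENNReal.ofReal l) (Or.inr (by simpa using hl))
    simpa using this
  · intro ε
    have hmax := measureReal_exists_lt_birkhoffSum_le hT (hE ε) l
    set B := {x | ∃ n : ℕ, l * n < birkhoffSum T ((E ε).indicator fun _ => (1 : ℝ)) n x} with hB
    have hpre : {ω | ∃ N : ℕ, l * N < ((Finset.range N).filter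
        (fun i => ‖X (c + i + 1) ω - X (c + i) ω‖ < ε)).card} =
        (fun ω (b : ℕ) => X b ω) ⁻¹' B := by
      ext ω
      simp only [Set.mem_ofPred_eq, hB, Set.mem_preimage, hsum]
    simp only
    rw [hpre]
    refine (Measure.le_map_apply hXm.aemeasurable B).trans ?_
    rw [ENNReal.le_div_iff_mul_le (Or.inl (by simpa using hl)) (Or.inl ENNReal.ofReal_ne_top),
      ← hν, mul_comm, ← ofReal_measureReal (μ := ν) (s := B),
      ← ofReal_measureReal (μ := ν) (s := E ε), ← ENNReal.ofReal_mul hl.le]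
    exact ENNReal.ofReal_le_ofReal hmax

/-! ### Outer codes: the Gilbert–Varshamov bound -/

section GilbertVarshamov

variable {A : Type*} [Fintype A] [DecidableEq A] {N : ℕ}

/-- A crude bound on the size of a Hamming ball: choose the positions at which the word may differ
from the centre, then the entries there. -/
lemma card_hammingBall_le [Nonempty A] (x : Fin N → A) (d : ℕ) :
    (Finset.univ.filter fun y => hammingDist x y ≤ d).card ≤ 2 ^ N * Fintype.card A ^ d := by
  classical
  let F : Finset (Fin N) → Finset (Fin N → A) := fun s =>
    Fintype.piFinset fun i => if i ∈ s then Finset.univ else {x i}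
  have hsub : (Finset.univ.filter fun y => hammingDist x y ≤ d) ⊆
      (Finset.univ.filter fun s : Finset (Fin N) => s.card ≤ d).biUnion F := by
    intro y hy
    rw [Finset.mem_filter] at hy
    refine Finset.mem_biUnion.2 ⟨Finset.univ.filter fun i => x i ≠ y i, ?_, ?_⟩
    · simpa [hammingDist] using hy.2
    · rw [Fintype.mem_piFinset]
      intro i
      by_cases h : x i = y i <;> simp [h]
  have hF : ∀ s ∈ Finset.univ.filter (fun s : Finset (Fin N) => s.card ≤ d),
      (F s).card ≤ Fintype.card A ^ d := by
    intro s hs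
    have hs' : s.card ≤ d := (Finset.mem_filter.1 hs).2
    have : (F s).card = Fintype.card A ^ s.card := by
      rw [Fintype.card_piFinset]
      simp only [apply_ite Finset.card, Finset.card_singleton, Finset.card_univ]
      rw [Finset.prod_ite]
      simp
    rw [this]
    exact Nat.pow_le_pow_right Fintype.card_pos hs'
  calc _ ≤ _ := Finset.card_le_card hsub
    _ ≤ _ := Finset.card_biUnion_le_card_mul _ _ _ hF
    _ ≤ _ := by
      refine Nat.mul_le_mul_right _ ((Finset.card_filter_le _ _).trans ?_)
      simp

/-- The Gilbert–Varshamov bound: a maximal code with distances above `d` is large, because the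
balls of radius `d` around its words cover the whole space. -/
theorem exists_code_lt_hammingDist [Nonempty A] (N d : ℕ) :
    ∃ C : Finset (Fin N → A), C.Nonempty ∧
      (∀ x ∈ C, ∀ y ∈ C, x ≠ y → d < hammingDist x y) ∧
      Fintype.card A ^ N ≤ C.card * (2 ^ N * Fintype.card A ^ d) := by
  classical
  let p : Finset (Fin N → A) → Prop := fun C => ∀ x ∈ C, ∀ y ∈ C, x ≠ y → d < hammingDist x y
  obtain ⟨C, hC⟩ := (Set.toFinite {C | p C}).exists_maximal ⟨∅, by simp [p]⟩
  have hcover : (Finset.univ : Finset (Fin N → A)) ⊆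
      C.biUnion fun x => Finset.univ.filter fun y => hammingDist x y ≤ d := by
    intro y _
    by_contra hy
    simp only [Finset.mem_biUnion, Finset.mem_filter, Finset.mem_univ, true_and, not_exists,
      not_and, not_le] at hy
    have hins : p (insert y C) := by
      intro a ha b hb hab
      rcases Finset.mem_insert.1 ha with rfl | ha' <;> rcases Finset.mem_insert.1 hb with rfl | hb'
      · exact absurd rfl hab
      · rw [hammingDist_comm]; exact hy b hb'
      · exact hy a ha'
      · exact hC.prop a ha' b hb' hab
    have hyC : y ∈ C := hC.le_of_ge hins (Finset.subset_insert y C) (Finset.mem_insert_self y C)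
    simpa using hy y hyC
  have hcard := Finset.card_le_card hcover
  rw [Finset.card_univ, Fintype.card_fun, Fintype.card_fin] at hcard
  have hbound := hcard.trans
    (Finset.card_biUnion_le_card_mul _ _ _ fun x _ => card_hammingBall_le x d)
  refine ⟨C, ?_, hC.prop, hbound⟩
  rw [Finset.nonempty_iff_ne_empty]
  rintro rfl
  simp at hbound

end GilbertVarshamov

/-! ### Signal constellations -/

/-- A real normed space of finite dimension `r` has constellations, which are the images of cubical
grids under a linear isomorphism, with any prescribed minimum distance `D`, of norm at most `ρ`, and
with at least `(ρ / c) ^ r` points, where `c` does not depend on `ρ`. -/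
theorem exists_separated_constellation (E : Type*) [NormedAddCommGroup E] [NormedSpace ℝ E]
    [FiniteDimensional ℝ E] (D : ℝ) :
    ∃ c : ℝ, 0 < c ∧ ∀ ρ : ℝ, 0 ≤ ρ →
      ∃ (L : ℕ) (φ : (Fin (Module.finrank ℝ E) → Fin (L + 1)) → E),
        ρ / c ≤ (L + 1 : ℕ) ∧ (∀ a, ‖φ a‖ ≤ ρ) ∧ ∀ a b, a ≠ b → D ≤ ‖φ a - φ b‖ := by
  let e : E ≃L[ℝ] (Fin (Module.finrank ℝ E) → ℝ) :=
    ContinuousLinearEquiv.ofFinrankEq (by simp)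
  let e₁ : E →L[ℝ] (Fin (Module.finrank ℝ E) → ℝ) := e
  let e₂ : (Fin (Module.finrank ℝ E) → ℝ) →L[ℝ] E := e.symm
  -- the mesh of the grid
  let δ : ℝ := (|D| + 1) * (‖e₁‖ + 1)
  let c : ℝ := (‖e₂‖ + 1) * δ
  have hδ : 0 < δ := by positivity
  have hc : 0 < c := by positivity
  refine ⟨c, hc, fun ρ hρ => ⟨⌊ρ / c⌋₊, fun a => e.symm fun i => δ * (a i : ℕ), ?_, ?_, ?_⟩⟩
  · push_cast
    exact (Nat.lt_floor_add_one _).le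
  · intro a
    have h1 : ‖fun i => δ * ((a i : ℕ) : ℝ)‖ ≤ δ * (ρ / c) := by
      rw [pi_norm_le_iff_of_nonneg (by positivity)]
      intro i
      rw [Real.norm_of_nonneg (by positivity)]
      have h2 : ((a i : ℕ) : ℝ) ≤ (⌊ρ / c⌋₊ : ℝ) := by
        exact_mod_cast Nat.lt_succ_iff.1 (a i).2
      have h3 : (⌊ρ / c⌋₊ : ℝ) ≤ ρ / c := Nat.floor_le (by positivity)
      exact mul_le_mul_of_nonneg_left (h2.trans h3) hδ.le
    calc ‖e.symm fun i => δ * ((a i : ℕ) : ℝ)‖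
        ≤ ‖e₂‖ * ‖fun i => δ * ((a i : ℕ) : ℝ)‖ :=
          e₂.le_opNorm _
      _ ≤ (‖e₂‖ + 1) * (δ * (ρ / c)) := by gcongr; linarith
      _ = ρ := by
          rw [← mul_assoc]
          exact mul_div_cancel₀ _ hc.ne'
  · intro a b hab
    obtain ⟨i, hi⟩ := Function.ne_iff.1 hab
    have hint : (1 : ℝ) ≤ |((a i : ℕ) : ℝ) - ((b i : ℕ) : ℝ)| := by
      have h : ((a i : ℕ) : ℤ) - ((b i : ℕ) : ℤ) ≠ 0 := by
        intro h
        exact hi (Fin.ext (by omega))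
      exact_mod_cast Int.one_le_abs h
    set u : Fin (Module.finrank ℝ E) → ℝ := fun i => δ * ((a i : ℕ) : ℝ)
    set w : Fin (Module.finrank ℝ E) → ℝ := fun i => δ * ((b i : ℕ) : ℝ)
    have h1 : δ ≤ ‖u - w‖ := by
      refine le_trans ?_ (norm_le_pi_norm (u - w) i)
      simp only [u, w, Pi.sub_apply, ← mul_sub, Real.norm_eq_abs, abs_mul, abs_of_pos hδ]
      exact le_mul_of_one_le_right hδ.le hint
    have h2 : ‖u - w‖ ≤ ‖e₁‖ * ‖e.symm u - e.symm w‖ := by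
      simpa [e₁] using e₁.le_opNorm (e.symm u - e.symm w)
    have h3 : (|D| + 1) * (‖e₁‖ + 1) ≤
        ‖e.symm u - e.symm w‖ * (‖e₁‖ + 1) := by
      calc _ ≤ _ := h1
        _ ≤ _ := h2
        _ ≤ _ := by
          rw [mul_comm]
          gcongr
          linarith
    have h4 := le_of_mul_le_mul_right h3 (by positivity)
    linarith [le_abs_self D]

/-! ### Rare large noise samples -/

/-- For a product measure, the probability that at least `m` coordinates lie in a set `B`, by a
union bound over the sets of coordinates. -/
theorem measure_pi_le_card_filter_le {α : Type*} [MeasurableSpace α] (ν : Measure α)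
    [IsProbabilityMeasure ν] (B : Set α) [DecidablePred (· ∈ B)] (n m : ℕ) :
    (Measure.pi fun _ : Fin n => ν) {z | m ≤ (Finset.univ.filter fun t => z t ∈ B).card} ≤
      2 ^ n * ν B ^ m := by
  classical
  let F : Finset (Fin n) → Set (Fin n → α) := fun s =>
    Set.pi Set.univ fun t => if t ∈ s then B else Set.univ
  have hsub : {z : Fin n → α | m ≤ (Finset.univ.filter fun t => z t ∈ B).card} ⊆
      ⋃ s ∈ (Finset.univ : Finset (Fin n)).powersetCard m, F s := by
    intro z hz
    obtain ⟨s, hs, hsm⟩ := Finset.exists_subset_card_eq hz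
    refine Set.mem_biUnion (Finset.mem_powersetCard.2 ⟨Finset.subset_univ s, hsm⟩) ?_
    intro t _
    by_cases h : t ∈ s
    · simpa [h] using (Finset.mem_filter.1 (hs h)).2
    · simp [h]
  have hF : ∀ s ∈ (Finset.univ : Finset (Fin n)).powersetCard m,
      (Measure.pi fun _ : Fin n => ν) (F s) = ν B ^ m := by
    intro s hs
    rw [Measure.pi_pi]
    simp only [apply_ite ν, measure_univ]
    rw [Finset.prod_ite]
    simp [(Finset.mem_powersetCard.1 hs).2]
  calc _ ≤ _ := measure_mono hsub
    _ ≤ ∑ s ∈ (Finset.univ : Finset (Fin n)).powersetCard m,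
        (Measure.pi fun _ : Fin n => ν) (F s) := measure_biUnion_finset_le _ _
    _ = ((Finset.univ : Finset (Fin n)).powersetCard m).card * ν B ^ m := by
        rw [Finset.sum_congr rfl hF]; simp
    _ ≤ _ := by
        gcongr
        have h : ((Finset.univ : Finset (Fin n)).powersetCard m).card ≤ 2 ^ n := by
          rw [Finset.card_powersetCard, Finset.card_univ, Fintype.card_fin]
          exact Nat.choose_le_two_pow n m
        exact_mod_cast h

/-- The tails of a probability measure on a normed space become arbitrarily light. -/
lemma exists_measureReal_norm_ge_lt {E : Type*} [NormedAddCommGroup E] [MeasurableSpace E]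
    [BorelSpace E] (ν : Measure E) [IsProbabilityMeasure ν] {δ : ℝ} (hδ : 0 < δ) :
    ∃ τ : ℝ, 0 < τ ∧ ν.real {z | τ ≤ ‖z‖} < δ := by
  have h := tendsto_measure_iInter_atTop (μ := ν) (s := fun n : ℕ => {z : E | (n : ℝ) ≤ ‖z‖})
    (fun n => (measurableSet_le measurable_const measurable_norm).nullMeasurableSet)
    (fun m n hmn z (hz : (n : ℝ) ≤ ‖z‖) => le_trans (Nat.cast_le.2 hmn) hz) ⟨0, measure_ne_top _ _⟩
  have h0 : (⋂ n : ℕ, {z : E | (n : ℝ) ≤ ‖z‖}) = ∅ := by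
    ext z
    obtain ⟨n, hn⟩ := exists_nat_gt ‖z‖
    simp only [Set.mem_iInter, Set.mem_ofPred_eq, Set.mem_empty_iff_false, iff_false, not_forall]
    exact ⟨n, not_le.2 hn⟩
  rw [h0, measure_empty] at h
  have h' : Tendsto (fun n : ℕ => ν.real {z : E | (n : ℝ) ≤ ‖z‖}) atTop (𝓝 0) := by
    exact (ENNReal.tendsto_toReal ENNReal.zero_ne_top).comp h
  obtain ⟨n, hn, hn1⟩ := ((h'.eventually_lt_const hδ).and (eventually_ge_atTop 1)).exists
  exact ⟨n, by exact_mod_cast hn1, hn⟩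

/-! ### Supersymbols -/

/-- The first slot of the `i`-th supersymbol that is complete from time zero on. -/
def firstSlot (s i : ℕ) : ℕ := (s + 1) % 2 + 2 * i

lemma crossBlock_firstSlot (s i : ℕ) : crossBlock s (firstSlot s i) = s / 2 + 1 + i := by
  unfold crossBlock firstSlot; omega

lemma crossBlock_firstSlot_succ (s i : ℕ) :
    crossBlock s (firstSlot s i + 1) = s / 2 + 1 + i := by
  unfold crossBlock firstSlot; omega

lemma directBlock_firstSlot (s i : ℕ) : directBlock s (firstSlot s i) = s / 2 + i := by
  unfold directBlock firstSlot; omega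

lemma directBlock_firstSlot_succ (s i : ℕ) :
    directBlock s (firstSlot s i + 1) = s / 2 + i + 1 := by
  unfold directBlock firstSlot; omega

/-- Two consecutive slots in one cross block meet two consecutive direct blocks. -/
lemma directBlock_succ_of_crossBlock_eq {s t : ℕ} (h : crossBlock s t = crossBlock s (t + 1)) :
    directBlock s (t + 1) = directBlock s t + 1 := by
  unfold crossBlock at h; unfold directBlock; omega

/-- At least `(n - 1) / 2` supersymbols are complete within the first `n` slots. -/
lemma firstSlot_succ_lt (s : ℕ) {n : ℕ} (i : Fin ((n - 1) / 2)) : firstSlot s i + 1 < n := by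
  have := i.2
  unfold firstSlot; omega

/-- The signal that repeats the `i`-th symbol of `x` over the `i`-th supersymbol, and is zero outside
of these supersymbols. -/
def repetitionSignal {𝕜 : Type*} [Zero 𝕜] (s : ℕ) {N : ℕ} (x : Fin N → 𝕜) (t : ℕ) : 𝕜 :=
  if h : s / 2 + 1 ≤ crossBlock s t ∧ crossBlock s t - (s / 2 + 1) < N then x ⟨_, h.2⟩ else 0

section RepetitionSignal

variable {𝕜 : Type*} [Zero 𝕜] {s N : ℕ} (x : Fin N → 𝕜)

lemma repetitionSignal_of_crossBlock_eq {t : ℕ} {i : Fin N}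
    (ht : crossBlock s t = s / 2 + 1 + i) : repetitionSignal s x t = x i := by
  have h : s / 2 + 1 ≤ crossBlock s t ∧ crossBlock s t - (s / 2 + 1) < N := by
    have := i.2
    omega
  rw [repetitionSignal, dif_pos h]
  congr 1
  ext
  simp only
  omega

lemma repetitionSignal_congr {t t' : ℕ} (h : crossBlock s t = crossBlock s t') :
    repetitionSignal s x t = repetitionSignal s x t' := by
  unfold repetitionSignal
  simp only [h]

end RepetitionSignal

/-- Zero-forcing of the interference: the difference of the samples `u` in the two slots of the
`i`-th supersymbol. -/
def slotDiff {𝕜 : Type*} [Sub 𝕜] (s : ℕ) {n : ℕ} (u : Fin n → 𝕜) (i : Fin ((n - 1) / 2)) : 𝕜 :=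
  u ⟨firstSlot s i + 1, firstSlot_succ_lt s i⟩ -
    u ⟨firstSlot s i, (Nat.lt_succ_self _).trans (firstSlot_succ_lt s i)⟩

/-! ### The decoder -/

open Classical in
/-- The supersymbols at which the received signal `y`, for the direct channel `h`, fails to support
the codeword `x`: the zero-forced channel is weaker than `ε`, or the zero-forced signal is at
distance at least `τ` from the one that `x` would cause without noise. -/
noncomputable def mismatches {𝕜 : Type*} [RCLike 𝕜] (s : ℕ) {n : ℕ} (ε τ : ℝ)
    (x : Fin ((n - 1) / 2) → 𝕜) (h y : Fin n → 𝕜) : Finset (Fin ((n - 1) / 2)) :=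
  Finset.univ.filter fun i =>
    ‖slotDiff s h i‖ < ε ∨ τ ≤ ‖slotDiff s y i - slotDiff s h i * x i‖

section Decoder

variable {𝕜 : Type*} [RCLike 𝕜] {s n : ℕ} {ε τ : ℝ}

lemma measurableSet_card_mismatches_le (x : Fin ((n - 1) / 2) → 𝕜) (D : ℝ) :
    MeasurableSet {p : (Fin n → 𝕜) × (Fin n → 𝕜) |
      ((mismatches s ε τ x p.1 p.2).card : ℝ) ≤ D} := by
  classical
  refine measurableSet_le ?_ measurable_const
  simp only [mismatches, Finset.card_filter]
  push_cast
  refine Finset.measurable_sum _ fun i _ => Measurable.ite ?_ measurable_const measurable_const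
  refine MeasurableSet.union ?_ ?_
  · exact measurableSet_lt (f := fun p : (Fin n → 𝕜) × (Fin n → 𝕜) => ‖slotDiff s p.1 i‖)
      (by unfold slotDiff; fun_prop) measurable_const
  · exact measurableSet_le (g := fun p : (Fin n → 𝕜) × (Fin n → 𝕜) =>
      ‖slotDiff s p.2 i - slotDiff s p.1 i * x i‖) measurable_const (by unfold slotDiff; fun_prop)

/-- A received signal cannot support two codewords that are well separated at more than `2 * D`
positions. -/
lemma not_card_mismatches_le_of_separated {x x' : Fin ((n - 1) / 2) → 𝕜} {D : ℝ}
    {A : Finset (Fin ((n - 1) / 2))} (hA : 2 * D < A.card)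
    (hsep : ∀ i ∈ A, 2 * τ ≤ ε * ‖x i - x' i‖) (h y : Fin n → 𝕜)
    (hx : ((mismatches s ε τ x h y).card : ℝ) ≤ D) :
    ¬ ((mismatches s ε τ x' h y).card : ℝ) ≤ D := by
  classical
  intro hx'
  have hsub : A ⊆ mismatches s ε τ x h y ∪ mismatches s ε τ x' h y := by
    intro i hi
    by_contra hcon
    simp only [mismatches, Finset.mem_union, Finset.mem_filter, Finset.mem_univ, true_and,
      not_or, not_lt, not_le] at hcon
    obtain ⟨⟨h1, h2⟩, -, h3⟩ := hcon
    have h4 : ‖slotDiff s h i‖ * ‖x i - x' i‖ < 2 * τ := by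
      rw [← norm_mul]
      calc ‖slotDiff s h i * (x i - x' i)‖
          = ‖(slotDiff s y i - slotDiff s h i * x' i) -
              (slotDiff s y i - slotDiff s h i * x i)‖ := by congr 1; ring
        _ ≤ _ := norm_sub_le _ _
        _ < 2 * τ := by linarith
    have h5 := mul_le_mul_of_nonneg_right h1 (norm_nonneg (x i - x' i))
    linarith [hsep i hi]
  have hc : (A.card : ℝ) ≤ (mismatches s ε τ x h y).card + (mismatches s ε τ x' h y).card := by
    exact_mod_cast (Finset.card_le_card hsub).trans (Finset.card_union_le _ _)
  linarith

end Decoder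

/-- Finitely many disjoint measurable sets can be told apart by a measurable function. -/
lemma exists_measurable_eq_of_mem_of_pairwise_disjoint {X ι : Type*} [MeasurableSpace X]
    [Finite ι] [Nonempty ι] [MeasurableSpace ι] [DiscreteMeasurableSpace ι] {B : ι → Set X}
    (hB : ∀ m, MeasurableSet (B m)) (hd : ∀ m m' x, x ∈ B m → x ∈ B m' → m = m') :
    ∃ f : X → ι, Measurable f ∧ ∀ m, ∀ x ∈ B m, f x = m := by
  classical
  let m₀ : ι := Classical.arbitrary ι
  let f : X → ι := fun x => if h : ∃ m, x ∈ B m then h.choose else m₀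
  have hf : ∀ m, ∀ x ∈ B m, f x = m := by
    intro m x hx
    have h : ∃ m, x ∈ B m := ⟨m, hx⟩
    simp only [f, dif_pos h]
    exact hd _ _ _ h.choose_spec hx
  refine ⟨f, measurable_to_countable' fun m => ?_, hf⟩
  have hpre : f ⁻¹' {m} = B m ∪ (if m = m₀ then (⋃ m', B m')ᶜ else ∅) := by
    ext x
    simp only [Set.mem_preimage, Set.mem_singleton_iff, Set.mem_union]
    by_cases h : ∃ m', x ∈ B m'
    · obtain ⟨m', hm'⟩ := h
      rw [hf m' x hm']
      constructor
      · rintro rfl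
        exact Or.inl hm'
      · rintro (h1 | h1)
        · exact hd _ _ _ hm' h1
        · split_ifs at h1
          · exact absurd (Set.mem_iUnion.2 ⟨m', hm'⟩) h1
          · exact h1.elim
    · have h1 : x ∉ B m := fun hx => h ⟨m, hx⟩
      have h2 : x ∉ ⋃ m', B m' := fun hx => h (Set.mem_iUnion.1 hx)
      simp only [f, dif_neg h, h1, false_or]
      split_ifs with h3
      · simp only [h3, true_iff]
        exact h2
      · simp only [Set.mem_empty_iff_false, iff_false]
        exact fun h4 => h3 h4.symm
  rw [hpre]
  refine (hB m).union ?_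
  split_ifs
  · exact (MeasurableSet.iUnion hB).compl
  · exact MeasurableSet.empty

/-! ### Error probability of repetition codes -/

instance isProbabilityMeasure_awgn (𝕜 : Type*) [RCLike 𝕜] (v : ℝ≥0) :
    IsProbabilityMeasure (awgn 𝕜 v) := by
  refine Measure.isProbabilityMeasure_map (Measurable.aemeasurable ?_)
  exact ((RCLike.measurable_ofReal.comp measurable_fst).add
    ((RCLike.measurable_ofReal.comp measurable_snd).mul_const _))

namespace ICCode

variable {𝕜 : Type*} [RCLike 𝕜] {K n : ℕ} {P : ℝ≥0}

/-- The average over the messages is at most the worst case. -/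
lemma errorProb_le_of_forall (c : ICCode 𝕜 K n P) (v : ℝ≥0) (h : ℕ → Fin K → Fin K → 𝕜) {β : ℝ}
    (hβ : ∀ m, (Measure.pi fun _ : Fin n => Measure.pi fun _ : Fin K => awgn 𝕜 v).real
      {z | ∃ k, c.dec k (fun t => h t k) (c.received h m z k) ≠ m k} ≤ β) :
    c.errorProb v h ≤ β := by
  have hpos : (0 : ℝ) < ∏ k, (c.M k : ℝ) :=
    Finset.prod_pos fun k _ => by exact_mod_cast c.M_pos k
  rw [errorProb, div_le_iff₀ hpos]
  refine (Finset.sum_le_sum fun m _ => hβ m).trans (le_of_eq ?_)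
  rw [Finset.sum_const, Finset.card_univ, Fintype.card_pi, nsmul_eq_mul, mul_comm]
  simp

lemma errorProb_nonneg (c : ICCode 𝕜 K n P) (v : ℝ≥0) (h : ℕ → Fin K → Fin K → 𝕜) :
    0 ≤ c.errorProb v h :=
  div_nonneg (Finset.sum_nonneg fun _ _ => measureReal_nonneg)
    (Finset.prod_nonneg fun _ _ => Nat.cast_nonneg _)

/-- The code with a single message and zero signals. -/
lemma exists_isRepetition (𝕜 : Type*) [RCLike 𝕜] (K n s : ℕ) (P : ℝ≥0) :
    ∃ C : ICCode 𝕜 K n P, C.IsRepetition s :=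
  ⟨{ M := fun _ => 1
     M_pos := fun _ => one_pos
     enc := fun _ _ _ => 0
     power_le := fun _ _ => by simpa using by positivity
     dec := fun _ _ _ => 0
     measurable_dec := fun _ => measurable_const }, fun _ _ _ _ _ => rfl⟩

end ICCode

/-- If the mismatches of the codeword that was sent are more than `2 * D`, although the zero-forced
channel is weak at no more than `D` supersymbols, then the noise is large in at least `D` slots. -/
lemma le_card_norm_ge_of_lt_card_mismatches {𝕜 : Type*} [RCLike 𝕜] {s n : ℕ} {ε τ D : ℝ}
    {x : Fin ((n - 1) / 2) → 𝕜} {h y z : Fin n → 𝕜}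
    (hy : ∀ i, slotDiff s y i = slotDiff s h i * x i + slotDiff s z i)
    (hweak : ((Finset.univ.filter fun i : Fin ((n - 1) / 2) =>
      ‖slotDiff s h i‖ < ε).card : ℝ) ≤ D)
    (hmis : 2 * D < (mismatches s ε τ x h y).card) :
    D ≤ ((Finset.univ.filter fun t => τ / 2 ≤ ‖z t‖).card : ℝ) := by
  classical
  set W := Finset.univ.filter fun i : Fin ((n - 1) / 2) => ‖slotDiff s h i‖ < ε
  set G := Finset.univ.filter fun i : Fin ((n - 1) / 2) => τ ≤ ‖slotDiff s z i‖ with hG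
  have hsub : mismatches s ε τ x h y ⊆ W ∪ G := by
    intro i hi
    rw [mismatches, Finset.mem_filter] at hi
    rw [Finset.mem_union]
    refine hi.2.imp (fun h1 => by simpa [W] using h1) fun h1 => ?_
    rw [hy i, add_sub_cancel_left] at h1
    simpa [G] using h1
  have hlt : ∀ i : Fin ((n - 1) / 2), firstSlot s i < n := fun i =>
    (Nat.lt_succ_self _).trans (firstSlot_succ_lt s i)
  let g : Fin ((n - 1) / 2) → Fin n := fun i =>
    if τ / 2 ≤ ‖z ⟨firstSlot s i, hlt i⟩‖ then ⟨firstSlot s i, hlt i⟩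
    else ⟨firstSlot s i + 1, firstSlot_succ_lt s i⟩
  have hGcard : G.card ≤ (Finset.univ.filter fun t => τ / 2 ≤ ‖z t‖).card := by
    refine Finset.card_le_card_of_injOn g ?_ ?_
    · intro i hi
      have hi' : τ ≤ ‖slotDiff s z i‖ := by simpa [hG] using hi
      simp only [Finset.coe_filter, Finset.mem_univ, true_and, Set.mem_ofPred_eq, g]
      split_ifs with h1
      · exact h1
      · have h2 := hi'.trans (norm_sub_le _ _)
        linarith
    · intro i _ j _ hij
      have h1 : (g i : ℕ) = g j := congrArg Fin.val hij
      have h2 : ∀ i, (g i : ℕ) = firstSlot s i ∨ (g i : ℕ) = firstSlot s i + 1 := by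
        intro i
        simp only [g]
        split_ifs <;> simp
      ext
      have h3 := h2 i
      have h4 := h2 j
      unfold firstSlot at h3 h4
      omega
  have h1 : ((mismatches s ε τ x h y).card : ℝ) ≤ W.card + G.card := by
    exact_mod_cast (Finset.card_le_card hsub).trans (Finset.card_union_le _ _)
  have h2 : (G.card : ℝ) ≤ ((Finset.univ.filter fun t => τ / 2 ≤ ‖z t‖).card : ℝ) := by
    exact_mod_cast hGcard
  linarith

/-- A set of codewords that are pairwise well separated at more than `4 * D` positions gives a
repetition code that is reliable on every channel realization for which the interference is aligned
and the zero-forced direct channels are weak at no more than `D` supersymbols. -/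
theorem exists_isRepetition_errorProb_le {𝕜 : Type*} [RCLike 𝕜] {K n M : ℕ} (s : ℕ) {P : ℝ≥0}
    (hM : 0 < M) (x : Fin M → Fin ((n - 1) / 2) → 𝕜) (hx : ∀ m i, ‖x m i‖ ^ 2 ≤ P)
    {ε τ D : ℝ} (A : Fin M → Fin M → Finset (Fin ((n - 1) / 2)))
    (hA : ∀ m m', m ≠ m' → 4 * D < (A m m').card)
    (hsep : ∀ m m', ∀ i ∈ A m m', 2 * τ ≤ ε * ‖x m i - x m' i‖) (v : ℝ≥0) :
    ∃ C : ICCode 𝕜 K n P, C.IsRepetition s ∧ (∀ k, C.M k = M) ∧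
      ∀ h : ℕ → Fin K → Fin K → 𝕜,
        (∀ i k j, j ≠ k → h (firstSlot s i + 1) k j = h (firstSlot s i) k j) →
        (∀ k, ((Finset.univ.filter fun i : Fin ((n - 1) / 2) =>
          ‖h (firstSlot s i + 1) k k - h (firstSlot s i) k k‖ < ε).card : ℝ) ≤ D) →
        C.errorProb v h ≤ K * (2 ^ n * (awgn 𝕜 v).real {z | τ / 2 ≤ ‖z‖} ^ ⌈D⌉₊) := by
  classical
  have : Nonempty (Fin M) := ⟨⟨0, hM⟩⟩
  let B : Fin M → Set ((Fin n → 𝕜) × (Fin n → 𝕜)) := fun m =>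
    {p | ((mismatches s ε τ (x m) p.1 p.2).card : ℝ) ≤ 2 * D}
  obtain ⟨f, hfm, hf⟩ := exists_measurable_eq_of_mem_of_pairwise_disjoint (B := B)
    (fun m => measurableSet_card_mismatches_le _ _) (by
      intro m m' p hp hp'
      by_contra hne
      exact not_card_mismatches_le_of_separated (by linarith [hA m m' hne]) (hsep m m') p.1 p.2
        hp hp')
  let C : ICCode 𝕜 K n P :=
    { M := fun _ => M
      M_pos := fun _ => hM
      enc := fun _ m t => repetitionSignal s (x m) t
      power_le := by
        intro k m
        refine (Finset.sum_le_card_nsmul _ _ (P : ℝ) fun t _ => ?_).trans (by simp)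
        unfold repetitionSignal
        split_ifs
        · exact hx _ _
        · simp
      dec := fun k h y => f (fun t => h t k, y)
      measurable_dec := fun k => hfm.comp (by fun_prop) }
  refine ⟨C, fun k m t t' htt => repetitionSignal_congr _ htt, fun k => rfl, ?_⟩
  intro h hal hweak
  refine C.errorProb_le_of_forall v h fun m => ?_
  set ν : Measure (Fin K → 𝕜) := Measure.pi fun _ : Fin K => awgn 𝕜 v with hν
  have hsub : {z | ∃ k, C.dec k (fun t => h t k) (C.received h m z k) ≠ m k} ⊆
      ⋃ k : Fin K, {z : Fin n → Fin K → 𝕜 | ⌈D⌉₊ ≤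
        (Finset.univ.filter fun t => z t ∈ {w : Fin K → 𝕜 | τ / 2 ≤ ‖w k‖}).card} := by
    rintro z ⟨k, hk⟩
    refine Set.mem_iUnion.2 ⟨k, ?_⟩
    have hmis : 2 * D < (mismatches s ε τ (x (m k)) (fun t => h t k k)
        (C.received h m z k)).card := by
      by_contra hle
      exact hk (hf (m k) _ (not_lt.1 hle))
    have hy : ∀ i, slotDiff s (C.received h m z k) i =
        slotDiff s (fun t : Fin n => h t k k) i * x (m k) i + slotDiff s (fun t => z t k) i := by
      intro i
      have e1 : ∀ j, repetitionSignal s (x (m j)) (firstSlot s i) = x (m j) i := fun j =>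
        repetitionSignal_of_crossBlock_eq _ (crossBlock_firstSlot s i)
      have e2 : ∀ j, repetitionSignal s (x (m j)) (firstSlot s i + 1) = x (m j) i := fun j =>
        repetitionSignal_of_crossBlock_eq _ (crossBlock_firstSlot_succ s i)
      have e3 : ∑ j, h (firstSlot s i + 1) k j * x (m j) i -
          ∑ j, h (firstSlot s i) k j * x (m j) i =
          (h (firstSlot s i + 1) k k - h (firstSlot s i) k k) * x (m k) i := by
        rw [← Finset.sum_sub_distrib, Finset.sum_eq_single k]
        · ring
        · intro j _ hj
          rw [hal i k j hj, sub_self]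
        · simp
      simp only [slotDiff, ICCode.received, C, e1, e2]
      rw [← e3]
      ring
    have := le_card_norm_ge_of_lt_card_mismatches hy (hweak k) hmis
    exact Nat.ceil_le.2 this
  have hprob : ∀ k : Fin K, (Measure.pi fun _ : Fin n => ν).real {z : Fin n → Fin K → 𝕜 | ⌈D⌉₊ ≤
      (Finset.univ.filter fun t => z t ∈ {w : Fin K → 𝕜 | τ / 2 ≤ ‖w k‖}).card} ≤
      2 ^ n * (awgn 𝕜 v).real {z | τ / 2 ≤ ‖z‖} ^ ⌈D⌉₊ := by
    intro k
    have h1 := measure_pi_le_card_filter_le ν {w : Fin K → 𝕜 | τ / 2 ≤ ‖w k‖} n ⌈D⌉₊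
    have h2 : ν {w : Fin K → 𝕜 | τ / 2 ≤ ‖w k‖} = awgn 𝕜 v {z | τ / 2 ≤ ‖z‖} :=
      (measurePreserving_eval (fun _ : Fin K => awgn 𝕜 v) k).measure_preimage
        (measurableSet_le measurable_const measurable_norm).nullMeasurableSet
    rw [h2] at h1
    have h3 := ENNReal.toReal_mono (ENNReal.mul_ne_top (by simp)
      (ENNReal.pow_ne_top (measure_ne_top _ _))) h1
    simpa [Measure.real] using h3
  calc _ ≤ _ := measureReal_mono hsub
    _ ≤ _ := measureReal_iUnion_fintype_le _
    _ ≤ ∑ k : Fin K, 2 ^ n * (awgn 𝕜 v).real {z | τ / 2 ≤ ‖z‖} ^ ⌈D⌉₊ :=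
        Finset.sum_le_sum fun k _ => hprob k
    _ = _ := by simp

/-! ### Codes for a given fraction of weak supersymbols -/

/-- The logarithm of the Gilbert–Varshamov bound, for a minimum distance of a fraction `4 * l` of
the length and an alphabet of at least `exp B` letters. -/
lemma le_log_card_of_gilbertVarshamov {N M Q : ℕ} {l B : ℝ} (hl : 0 ≤ l) (hl4 : l ≤ 1 / 4)
    (hM : 0 < M) (hQ : 0 < Q) (hB : B ≤ Real.log Q)
    (h : Q ^ N ≤ M * (2 ^ N * Q ^ ⌊4 * l * N⌋₊)) :
    N * ((1 - 4 * l) * B - Real.log 2) ≤ Real.log M := by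
  have hM' : (0 : ℝ) < M := by exact_mod_cast hM
  have hQ' : (0 : ℝ) < Q := by exact_mod_cast hQ
  have h1 : (Q : ℝ) ^ N ≤ M * (2 ^ N * Q ^ ⌊4 * l * N⌋₊) := by exact_mod_cast h
  have h2 := Real.log_le_log (by positivity) h1
  rw [Real.log_mul hM'.ne' (by positivity), Real.log_mul (by positivity) (by positivity),
    Real.log_pow, Real.log_pow, Real.log_pow] at h2
  have h3 : (⌊4 * l * N⌋₊ : ℝ) ≤ 4 * l * N := Nat.floor_le (by positivity)
  have h4 : 0 ≤ Real.log Q := Real.log_natCast_nonneg Q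
  have h5 := mul_le_mul_of_nonneg_right h3 h4
  have h6 : (N : ℝ) * ((1 - 4 * l) * B) ≤ N * ((1 - 4 * l) * Real.log Q) := by
    have : 0 ≤ 1 - 4 * l := by linarith
    gcongr
  linarith

/-- The codes `C` of power `P`, one for every length, repeat each symbol over a supersymbol, have
`(1 - 6 * l) / 2` degrees of freedom for every user, and are reliable on every channel realization
with aligned interference for which never more than a fraction `l` of the zero-forced channels has
been smaller than `ε`. -/
def IsReliableRepetition {𝕜 : Type*} [RCLike 𝕜] {K : ℕ} (s : ℕ) (v : ℝ≥0) (ε l : ℝ) {P : ℝ≥0}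
    (C : (n : ℕ) → ICCode 𝕜 K n P) : Prop :=
  (∀ n, (C n).IsRepetition s) ∧
  (∀ k, ∀ᶠ n : ℕ in atTop, Real.exp (n * ((1 - 6 * l) / 2 *
    ((Module.finrank ℝ 𝕜 : ℝ) / 2 * Real.log P))) ≤ ((C n).M k : ℝ)) ∧
  ∀ h : ℕ → Fin K → Fin K → 𝕜,
    (∀ i k j, j ≠ k → h (firstSlot s i + 1) k j = h (firstSlot s i) k j) →
    (∀ k, ∀ N : ℕ, (((Finset.range N).filter fun i =>
      ‖h (firstSlot s i + 1) k k - h (firstSlot s i) k k‖ < ε).card : ℝ) ≤ l * N) →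
    Tendsto (fun n => (C n).errorProb v h) atTop (𝓝 0)

/-- For fixed `ε` and `l`, an inner constellation of fixed minimum distance, which leaves a small
symbol error probability, and an outer Gilbert–Varshamov code that corrects a fraction `2 * l` of
symbol errors give reliable codes for all large powers. -/
theorem eventually_exists_isReliableRepetition (𝕜 : Type*) [RCLike 𝕜] (K s : ℕ) (v : ℝ≥0)
    {ε l : ℝ} (hε : 0 < ε) (hl : 0 < l) (hl5 : l ≤ 1 / 5) :
    ∀ᶠ P : ℝ≥0 in atTop, ∃ C : (n : ℕ) → ICCode 𝕜 K n P, IsReliableRepetition s v ε l C := by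
  classical
  -- The tail probability `q` of the noise is so small that `q ^ (l * N)` beats the factor `2 ^ n`
  -- of the union bound, where `n` is about `2 * N`.
  set δ : ℝ := (1 / 16 : ℝ) ^ (1 / l) with hδ
  have hδ0 : 0 < δ := by positivity
  have hδ1 : δ ≤ 1 := Real.rpow_le_one (by norm_num) (by norm_num) (by positivity)
  obtain ⟨τ, hτ, hq⟩ := exists_measureReal_norm_ge_lt (awgn 𝕜 v) hδ0
  set q := (awgn 𝕜 v).real {z | τ ≤ ‖z‖} with hqdef
  have hqpow : ∀ N : ℕ, q ^ ⌈l * N⌉₊ ≤ (1 / 16 : ℝ) ^ N := by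
    intro N
    calc q ^ ⌈l * N⌉₊ ≤ δ ^ ⌈l * N⌉₊ := by gcongr
      _ = δ ^ (⌈l * N⌉₊ : ℝ) := (Real.rpow_natCast _ _).symm
      _ ≤ δ ^ (l * N) := Real.rpow_le_rpow_of_exponent_ge hδ0 hδ1 (Nat.le_ceil _)
      _ = (1 / 16 : ℝ) ^ N := by
        rw [hδ, ← Real.rpow_mul (by norm_num), ← mul_assoc, one_div_mul_cancel hl.ne', one_mul,
          Real.rpow_natCast]
  obtain ⟨c, hc, hconst⟩ := exists_separated_constellation 𝕜 (4 * τ / ε)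
  set r := Module.finrank ℝ 𝕜 with hr
  have hr0 : 0 < r := Module.finrank_pos
  have hr0' : (0 : ℝ) < r := by exact_mod_cast hr0
  have hlogtop : Tendsto (fun P : ℝ≥0 => Real.log P) atTop atTop :=
    Real.tendsto_log_atTop.comp (NNReal.tendsto_coe_atTop.2 tendsto_id)
  have hlarge : Tendsto (fun P : ℝ≥0 => l * (r / 2 * Real.log P)) atTop atTop :=
    (hlogtop.const_mul_atTop (by positivity)).const_mul_atTop hl
  filter_upwards [eventually_gt_atTop 0, hlogtop.eventually_ge_atTop 0,
    hlarge.eventually_ge_atTop ((1 - 4 * l) * (r * Real.log c) + Real.log 2)] with P hP0 hlog0 hPl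
  set X : ℝ := r / 2 * Real.log P with hX
  have hX0 : 0 ≤ X := by positivity
  have hP0' : (0 : ℝ) < P := by exact_mod_cast hP0
  obtain ⟨L, φ, hL, hφP, hφsep⟩ := hconst (Real.sqrt P) (Real.sqrt_nonneg _)
  have hcard : Fintype.card (Fin r → Fin (L + 1)) = (L + 1) ^ r := by simp
  have hB : X - r * Real.log c ≤ Real.log (Fintype.card (Fin r → Fin (L + 1)) : ℕ) := by
    have h1 : Real.log (Real.sqrt P / c) ≤ Real.log (L + 1 : ℕ) :=
      Real.log_le_log (by positivity) hL
    rw [Real.log_div (by positivity) hc.ne', Real.log_sqrt hP0'.le] at h1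
    rw [hcard, Nat.cast_pow, Real.log_pow]
    have h2 := mul_le_mul_of_nonneg_left h1 hr0'.le
    calc X - r * Real.log c = r * (Real.log P / 2 - Real.log c) := by rw [hX]; ring
      _ ≤ _ := h2
  have hcode : ∀ n : ℕ, ∃ C : ICCode 𝕜 K n P, C.IsRepetition s ∧
      (∀ k, ((n - 1) / 2 : ℕ) * ((1 - 4 * l) * (X - r * Real.log c) - Real.log 2) ≤
        Real.log (C.M k)) ∧
      ∀ h : ℕ → Fin K → Fin K → 𝕜,
        (∀ i k j, j ≠ k → h (firstSlot s i + 1) k j = h (firstSlot s i) k j) →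
        (∀ k, ∀ N : ℕ, (((Finset.range N).filter fun i =>
          ‖h (firstSlot s i + 1) k k - h (firstSlot s i) k k‖ < ε).card : ℝ) ≤ l * N) →
        C.errorProb v h ≤ K * (2 ^ n * q ^ ⌈l * ((n - 1) / 2 : ℕ)⌉₊) := by
    intro n
    set N := (n - 1) / 2 with hN
    obtain ⟨W, hW, hWdist, hWcard⟩ :=
      exists_code_lt_hammingDist (A := Fin r → Fin (L + 1)) N ⌊4 * l * N⌋₊
    let w : Fin W.card → Fin N → Fin r → Fin (L + 1) := fun m => (W.equivFin.symm m : _)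
    obtain ⟨C, hrep, hCM, hCerr⟩ := exists_isRepetition_errorProb_le (K := K) (n := n) (P := P)
      s (Finset.card_pos.2 hW) (fun m i => φ (w m i)) (fun m i => by
        have h1 := pow_le_pow_left₀ (norm_nonneg _) (hφP (w m i)) 2
        rwa [Real.sq_sqrt hP0'.le] at h1)
      (ε := ε) (τ := 2 * τ) (D := l * N)
      (fun m m' => Finset.univ.filter fun i => w m i ≠ w m' i)
      (fun m m' hmm => by
        have h1 : w m ≠ w m' := fun h2 =>
          hmm (W.equivFin.symm.injective (Subtype.ext h2))
        have h2 := Nat.lt_of_floor_lt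
          (hWdist (w m) (W.equivFin.symm m).2 (w m') (W.equivFin.symm m').2 h1)
        rw [← mul_assoc]
        exact h2)
      (fun m m' i hi => by
        have h1 := hφsep _ _ (Finset.mem_filter.1 hi).2
        rw [div_le_iff₀ hε] at h1
        linarith) v
    refine ⟨C, hrep, fun k => ?_, fun h hal hweak => ?_⟩
    · rw [hCM k]
      exact le_log_card_of_gilbertVarshamov hl.le (by linarith) (Finset.card_pos.2 hW)
        Fintype.card_pos hB hWcard
    · have h1 := hCerr h hal fun k => by
        refine le_of_eq_of_le ?_ (hweak k N)
        rw [Finset.card_filter, Finset.card_filter, Finset.sum_range]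
      simpa [hqdef] using h1
  choose C hrep hrate herr using hcode
  have hhalf : ∀ n : ℕ, n ≤ 2 * ((n - 1) / 2) + 2 := fun n => by omega
  refine ⟨C, hrep, fun k => ?_, fun h hal hweak => ?_⟩
  · obtain ⟨n₀, hn₀⟩ := exists_nat_gt (2 / l)
    filter_upwards [eventually_ge_atTop n₀] with n hn
    have hn' : 2 ≤ l * n := by
      have h1 : 2 / l ≤ n := hn₀.le.trans (by exact_mod_cast hn)
      rw [div_le_iff₀ hl] at h1
      linarith
    rw [← Real.le_log_iff_exp_le (by exact_mod_cast (C n).M_pos k)]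
    refine le_trans ?_ (hrate n k)
    set N := (n - 1) / 2
    have hN : (n : ℝ) ≤ 2 * N + 2 := by exact_mod_cast hhalf n
    have h1 : (1 - 5 * l) * X ≤ (1 - 4 * l) * (X - r * Real.log c) - Real.log 2 := by linarith
    have h2 : n * ((1 - 6 * l) / 2) ≤ N * (1 - 5 * l) := by
      have h3 : ((n : ℝ) / 2 - 1) * (1 - 5 * l) ≤ N * (1 - 5 * l) :=
        mul_le_mul_of_nonneg_right (by linarith) (by linarith)
      nlinarith
    calc n * ((1 - 6 * l) / 2 * X) = n * ((1 - 6 * l) / 2) * X := by ring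
      _ ≤ N * (1 - 5 * l) * X := by gcongr
      _ = N * ((1 - 5 * l) * X) := by ring
      _ ≤ _ := by gcongr
  · have hgeom : Tendsto (fun n : ℕ => K * (16 * (1 / 2 : ℝ) ^ n)) atTop (𝓝 0) := by
      have h1 := ((tendsto_pow_atTop_nhds_zero_of_lt_one (r := (1 / 2 : ℝ)) (by norm_num)
        (by norm_num)).const_mul 16).const_mul (K : ℝ)
      simpa using h1
    refine squeeze_zero (fun n => (C n).errorProb_nonneg v h) (fun n => ?_) hgeom
    refine (herr n h hal hweak).trans ?_
    refine mul_le_mul_of_nonneg_left ?_ (Nat.cast_nonneg K)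
    set N := (n - 1) / 2
    calc (2 : ℝ) ^ n * q ^ ⌈l * N⌉₊ ≤ 2 ^ n * (1 / 16) ^ N := by gcongr; exact hqpow N
      _ = 2 ^ n * (16 * (1 / 4) ^ (2 * N + 2)) := by
        rw [pow_add, pow_mul]; norm_num; ring
      _ ≤ 2 ^ n * (16 * (1 / 4) ^ n) := by
        gcongr ?_ * (?_ * ?_)
        exact pow_le_pow_of_le_one (by norm_num) (by norm_num) (hhalf n)
      _ = 16 * (1 / 2) ^ n := by
        rw [mul_left_comm, ← mul_pow]; norm_num

/-! ### Letting the parameters depend on the power -/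

/-- If `p j x` holds for every `j` and all large `x`, then it holds for all large `x` with an index
`j = J x` that tends to infinity. -/
lemma exists_tendsto_atTop_eventually {p : ℕ → ℝ≥0 → Prop} (hp : ∀ j, ∀ᶠ x in atTop, p j x) :
    ∃ J : ℝ≥0 → ℕ, Tendsto J atTop atTop ∧ ∀ᶠ x in atTop, p (J x) x := by
  classical
  refine ⟨fun x => Nat.findGreatest (fun j => p j x) ⌊x⌋₊, tendsto_atTop.2 fun b => ?_, ?_⟩
  · filter_upwards [hp b, eventually_ge_atTop (b : ℝ≥0)] with x hx hbx
    exact Nat.le_findGreatest (Nat.le_floor hbx) hx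
  · filter_upwards [hp 0] with x hx
    exact Nat.findGreatest_spec (P := fun j => p j x) (Nat.zero_le _) hx

/-! ### Almost sure properties of the channel realization -/

lemma channel_cross_eq {𝕜 Ω : Type*} {K s t : ℕ} (S : ℕ → Fin K → Fin K → Ω → 𝕜)
    (ht : crossBlock s t = crossBlock s (t + 1)) {k j : Fin K} (hj : j ≠ k) (ω : Ω) :
    channel s S ω (t + 1) k j = channel s S ω t k j := by
  simp [channel, hj.symm, ht]

section Generic

variable {𝕜 : Type*} [RCLike 𝕜] {Ω : Type*} [MeasurableSpace Ω] {μ : Measure Ω} {K : ℕ}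
  {S : ℕ → Fin K → Fin K → Ω → 𝕜}

/-- The diagonal is a null set, so that a channel almost surely changes between two blocks. -/
lemma IsGenericBlockFading.ae_ne (hS : IsGenericBlockFading μ S) (b : ℕ) (k j : Fin K) :
    ∀ᵐ ω ∂μ, S b k j ω ≠ S (b + 1) k j ω := by
  have hd : MeasurableSet {p : 𝕜 × 𝕜 | p.1 = p.2} :=
    measurableSet_eq_fun measurable_fst measurable_snd
  have h0 : ((Measure.addHaar : Measure 𝕜).prod (Measure.addHaar : Measure 𝕜))
      {p : 𝕜 × 𝕜 | p.1 = p.2} = 0 := by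
    rw [Measure.measure_prod_null hd]
    refine Eventually.of_forall fun x => ?_
    have h1 : Prod.mk x ⁻¹' {p : 𝕜 × 𝕜 | p.1 = p.2} = {x} := by
      ext y
      simp [eq_comm]
    simp [h1]
  have h1 := hS.generic b k j h0
  rw [Measure.map_apply ((hS.measurable _ _ _).prodMk (hS.measurable _ _ _)) hd] at h1
  simpa [ae_iff] using h1

lemma IsGenericBlockFading.ae_interferenceAligned (hS : IsGenericBlockFading μ S) (s : ℕ) :
    ∀ᵐ ω ∂μ, InterferenceAligned s (channel s S ω) := by
  have h : ∀ᵐ ω ∂μ, ∀ b k, S b k k ω ≠ S (b + 1) k k ω :=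
    ae_all_iff.2 fun b => ae_all_iff.2 fun k => hS.ae_ne b k k
  filter_upwards [h] with ω hω t ht k
  refine ⟨fun j hj => ?_, ?_⟩
  · rw [receivedDirection, channel_cross_eq S ht hj, Submodule.mem_span_singleton]
    exact ⟨channel s S ω t k j, by simp⟩
  · have hne : channel s S ω t k k ≠ channel s S ω (t + 1) k k := by
      simp only [channel, if_true, directBlock_succ_of_crossBlock_eq ht]
      exact hω _ k
    rw [LinearIndependent.pair_iff]
    intro a b hab
    have h0 := congrFun hab 0
    have h1 := congrFun hab 1
    simp only [receivedDirection, Pi.add_apply, Pi.smul_apply, smul_eq_mul, Pi.zero_apply,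
      Matrix.cons_val_zero, Matrix.cons_val_one, mul_one] at h0 h1
    have ha : a = 0 := by
      have h2 : a * (channel s S ω t k k - channel s S ω (t + 1) k k) = 0 := by
        linear_combination h0 - h1
      exact (mul_eq_zero.1 h2).resolve_right (sub_ne_zero.2 hne)
    subst ha
    exact ⟨rfl, by simpa using h0⟩

/-- For a suitable choice of `ε j`, which depends on the channel statistics only, the fraction of
supersymbols at which a zero-forced direct channel is smaller than `ε j` never exceeds `l j`, for all
large `j`. This is the maximal inequality combined with the Borel–Cantelli lemma. -/
lemma IsGenericBlockFading.exists_ae_eventually_card_le [IsProbabilityMeasure μ]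
    (hS : IsGenericBlockFading μ S) (c : ℕ) {l : ℕ → ℝ} (hl : ∀ j, 0 < l j) :
    ∃ ε : ℕ → ℝ, (∀ j, 0 < ε j) ∧ ∀ᵐ ω ∂μ, ∀ᶠ j in atTop, ∀ k, ∀ N : ℕ,
      (((Finset.range N).filter fun i =>
        ‖S (c + i + 1) k k ω - S (c + i) k k ω‖ < ε j).card : ℝ) ≤ l j * N := by
  let B : Fin K → ℕ → ℝ → Set Ω := fun k j ε => {ω | ∃ N : ℕ,
    l j * N < ((Finset.range N).filter
      (fun i => ‖S (c + i + 1) k k ω - S (c + i) k k ω‖ < ε)).card}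
  have hex : ∀ j : ℕ, ∃ ε : ℝ, 0 < ε ∧ ∀ k, μ (B k j ε) < (2⁻¹ : ENNReal) ^ j := by
    intro j
    have h1 : ∀ᶠ ε in 𝓝[>] (0 : ℝ), ∀ k, μ (B k j ε) < (2⁻¹ : ENNReal) ^ j := by
      refine eventually_all.2 fun k => ?_
      refine (tendsto_measure_exists_card_small_increment (fun b => hS.measurable b k k)
        (hS.stationary k k) c (hS.ae_ne c k k) (hl j)).eventually_lt_const ?_
      exact ENNReal.pow_pos (by simp) j
    exact (eventually_mem_nhdsWithin.and h1).exists
  choose ε hε hμ using hex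
  refine ⟨ε, hε, ?_⟩
  have hbc : ∀ᵐ ω ∂μ, ∀ k, ∀ᶠ j in atTop, ω ∉ B k j (ε j) := by
    refine ae_all_iff.2 fun k => ae_eventually_notMem ?_
    refine ne_top_of_le_ne_top ?_ (ENNReal.tsum_le_tsum fun j => (hμ j k).le)
    rw [ENNReal.tsum_geometric]
    simp
  filter_upwards [hbc] with ω hω
  filter_upwards [eventually_all.2 hω] with j hj k N
  by_contra hN
  exact hj k ⟨N, not_le.1 hN⟩

end Generic

theorem theorem5 {𝕜 : Type*} [RCLike 𝕜] {Ω : Type*} [MeasurableSpace Ω]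
    (μ : Measure Ω) [IsProbabilityMeasure μ] (K s : ℕ) (v : ℝ≥0) (hv : v ≠ 0)
    (S : ℕ → Fin K → Fin K → Ω → 𝕜) (hS : IsGenericBlockFading μ S) :
    ∃ C : (P : ℝ≥0) → (n : ℕ) → ICCode 𝕜 K n P,
      (∀ P n, (C P n).IsRepetition s) ∧
      ∀ᵐ ω ∂μ,
        InterferenceAligned s (channel s S ω) ∧
        ∃ d : Fin K → ℝ, (∀ k, d k = 1 / 2) ∧ ∑ k, d k = (K : ℝ) / 2 ∧
          AchievesDoF v C d (channel s S ω) := by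
  classical
  let l : ℕ → ℝ := fun j => 1 / (j + 5)
  have hl0 : ∀ j, 0 < l j := fun j => by positivity
  have hl5 : ∀ j, l j ≤ 1 / 5 := fun j =>
    one_div_le_one_div_of_le (by norm_num) (by linarith [(Nat.cast_nonneg j : (0 : ℝ) ≤ j)])
  obtain ⟨ε, hε, hweak⟩ := hS.exists_ae_eventually_card_le (s / 2) hl0
  obtain ⟨J, hJ, hcode⟩ := exists_tendsto_atTop_eventually fun j =>
    eventually_exists_isReliableRepetition 𝕜 K s v (hε j) (hl0 j) (hl5 j)
  -- For powers that are too small for the construction, any repetition code will do.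
  have hC : ∀ P : ℝ≥0, ∃ C : (n : ℕ) → ICCode 𝕜 K n P, (∀ n, (C n).IsRepetition s) ∧
      ((∃ C' : (n : ℕ) → ICCode 𝕜 K n P, IsReliableRepetition s v (ε (J P)) (l (J P)) C') →
        IsReliableRepetition s v (ε (J P)) (l (J P)) C) := by
    intro P
    by_cases h : ∃ C' : (n : ℕ) → ICCode 𝕜 K n P,
        IsReliableRepetition s v (ε (J P)) (l (J P)) C'
    · obtain ⟨C', hC'⟩ := h
      exact ⟨C', hC'.1, fun _ => hC'⟩
    · choose C' hC' using fun n => ICCode.exists_isRepetition 𝕜 K n s P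
      exact ⟨C', hC', fun h' => absurd h' h⟩
  choose C hrep hprop using hC
  refine ⟨C, hrep, ?_⟩
  filter_upwards [hS.ae_interferenceAligned s, hweak] with ω hal hω
  refine ⟨hal, fun _ => 1 / 2, fun _ => rfl, by simp [div_eq_mul_inv], ?_⟩
  refine ⟨fun P _ => (1 - 6 * l (J P)) / 2 * ((Module.finrank ℝ 𝕜 : ℝ) / 2 * Real.log P),
    fun k => ?_, ?_⟩
  · have hlim : Tendsto (fun P : ℝ≥0 => (1 - 6 * l (J P)) / 2) atTop (𝓝 (1 / 2)) := by
      have h1 : Tendsto l atTop (𝓝 0) := by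
        have := tendsto_const_div_atTop_nhds_zero_nat (1 : ℝ)
        have h2 := (tendsto_add_atTop_iff_nat 5).2 this
        simpa [l] using h2
      have h2 := (((h1.comp hJ).const_mul 6).const_sub 1).div_const 2
      simpa using h2
    refine hlim.congr' ?_
    filter_upwards [eventually_gt_atTop 1] with P hP
    have h1 : 0 < Real.log P := Real.log_pos (by exact_mod_cast hP)
    have h2 : (0 : ℝ) < Module.finrank ℝ 𝕜 := by exact_mod_cast Module.finrank_pos
    rw [mul_div_assoc, div_self (by positivity), mul_one]
  · filter_upwards [hcode, hJ.eventually hω] with P hP hωP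
    obtain ⟨-, hrate, herr⟩ := hprop P hP
    refine ⟨hrate, herr _ (fun i k j hj => ?_) fun k N => ?_⟩
    · exact channel_cross_eq S
        ((crossBlock_firstSlot s i).trans (crossBlock_firstSlot_succ s i).symm) hj ω
    · simpa only [channel, if_true, directBlock_firstSlot, directBlock_firstSlot_succ]
        using hωP k N
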